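/- Let $r\ge 1$, let $D\subseteq\mathbb R^{2+(r+1)}$ be open, and let $H=H(t,x,u_0,\dots,u_r)$ be a $C^\infty$ function on $D$ with $\partial H/\partial u_r\neq 0$ on $D$. Consider the evolution equation $$\mathcal E:\quad u_t=H(t,x,u_0,u_1,\dots,u_r),\qquad u_0=u,\quad u_k=\partial^k u/\partial x^k .$$ Let $\rho\ge 0$, let $\Omega\subseteq\mathbb R\times\mathbb R\times\mathbb R^\rho$ be open, and let $f=f(t,x,\bar\varkappa)$, $\bar\varkappa=(\varkappa_1,\dots,\varkappa_\rho)$, be a $C^\infty$ function on $\Omega$ such that $u=f(t,x,\bar\varkappa)$ satisfies $\mathcal E$ on $\Omega$ (that is, on $\Omega$ the point $(t,x,f_0,\dots,f_r)$ lies in $D$ and $f_t=H(t,x,f_0,\dots,f_r)$), where $f_k=\partial^k f/\partial x^k$. For a set $V\subseteq\Omega$ open, the parameters $\varkappa_1,\dots,\varkappa_\rho$ are called essential on $V$ if there are no $\tilde\rho<\rho$, $C^\infty$ functions $\zeta^1,\dots,\zeta^{\tilde\rho}$ of $\bar\varkappa$ (defined on the projection of $V$ to the parameter space) and $C^\infty$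 function $\tilde f$ of $\tilde\rho+2$ arguments (defined on some open set containing all the points $(t,x,\zeta^1(\bar\varkappa),\dots,\zeta^{\tilde\rho}(\bar\varkappa))$ with $(t,x,\bar\varkappa)\in V$) such that $f(t,x,\bar\varkappa)=\tilde f(t,x,\zeta^1(\bar\varkappa),\dots,\zeta^{\tilde\rho}(\bar\varkappa))$ for all $(t,x,\bar\varkappa)\in V$. Put $$\Delta=\det\frac{\partial(f_0,\dots,f_{\rho-1})}{\partial(\varkappa_1,\dots,\varkappa_\rho)} .$$ Then all the parameters are (locally) essential if and only if $\Delta\ne0$, in the following two senses. (1) The parameters $\varkappa_1,\dots,\varkappa_\rho$ are essential on every nonempty open subset $V\subseteq\Omega$ if and only if $\Delta\neq0$ on a dense subset of $\Omega$. (2) Let $p\in\Omega$ be a regular point, i.e. a point such that for every $k\le\rho$ the rank of $\partial(f_0,\dots,f_{k-1})/\partial(\varkappa_1,\dots,\varkappa_\rho)$ is constant in a neighbourhood of $p$. Then the parameters are essential on every open neighbourhood $V\subseteq\Omega$ of $p$ if and only if $\Delta(p)\ne0$. -/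

import Mathlib

open Topology
open scoped ContDiff

/-- The `k`-th partial derivative `f_k = ∂^k f / ∂x^k` of `f(t, x, κ)` at `p = (t, x, κ)`. -/
noncomputable def xDeriv {ρ : ℕ} (f : ℝ × ℝ × (Fin ρ → ℝ) → ℝ) (k : ℕ)
    (p : ℝ × ℝ × (Fin ρ → ℝ)) : ℝ :=
  iteratedDeriv k (fun y : ℝ => f (p.1, y, p.2.2)) p.2.1

/-- The partial derivative `f_t` of `f(t, x, κ)` at `p = (t, x, κ)`. -/
noncomputable def tDeriv {ρ : ℕ} (f : ℝ × ℝ × (Fin ρ → ℝ) → ℝ)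
    (p : ℝ × ℝ × (Fin ρ → ℝ)) : ℝ :=
  deriv (fun s : ℝ => f (s, p.2.1, p.2.2)) p.1

/-- The Jacobian matrix `∂(f_0, …, f_{k-1}) / ∂(κ_1, …, κ_ρ)` at `p = (t, x, κ)`. -/
noncomputable def paramJacobian {ρ : ℕ} (f : ℝ × ℝ × (Fin ρ → ℝ) → ℝ) (k : ℕ)
    (p : ℝ × ℝ × (Fin ρ → ℝ)) : Matrix (Fin k) (Fin ρ) ℝ :=
  Matrix.of fun a b =>
    fderiv ℝ (fun κ : Fin ρ → ℝ => xDeriv f a (p.1, p.2.1, κ)) p.2.2 (Pi.single b 1)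

/-- An evolution equation `u_t = H(t, x, u_0, …, u_r)` of order `r ≥ 1`, where `H` is a smooth
function on an open subset of the space of the variables `(t, x, u_0, …, u_r)` and `H_{u_r}`
does not vanish there. -/
structure EvolutionEquation (r : ℕ) where
  one_le_order : 1 ≤ r
  domain : Set (ℝ × ℝ × (Fin (r + 1) → ℝ))
  isOpen_domain : IsOpen domain
  H : ℝ × ℝ × (Fin (r + 1) → ℝ) → ℝ
  smooth : ContDiffOn ℝ ∞ H domain
  nondegenerate : ∀ z ∈ domain,
    fderiv ℝ (fun v : Fin (r + 1) → ℝ => H (z.1, z.2.1, v)) z.2.2 (Pi.single (Fin.last r) 1) ≠ 0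

/-- `{u = f(t, x, κ)}` is a (smooth) `ρ`-parametric family of solutions of `E`, with `(t, x, κ)`
running through `Ω`. -/
def IsSolutionFamily {r ρ : ℕ} (E : EvolutionEquation r) (f : ℝ × ℝ × (Fin ρ → ℝ) → ℝ)
    (Ω : Set (ℝ × ℝ × (Fin ρ → ℝ))) : Prop :=
  ContDiffOn ℝ ∞ f Ω ∧
    ∀ p ∈ Ω, (p.1, p.2.1, fun k : Fin (r + 1) => xDeriv f k p) ∈ E.domain ∧
      tDeriv f p = E.H (p.1, p.2.1, fun k : Fin (r + 1) => xDeriv f k p)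

/-- All the parameters are essential in the family `{f(t, x, κ)}`, `(t, x, κ) ∈ V`: there are no
`m < ρ`, smooth functions `ζ¹, …, ζᵐ` of `κ` and smooth function `g` of `m + 2` arguments with
`f(t, x, κ) = g(t, x, ζ¹(κ), …, ζᵐ(κ))` on `V`. -/
def EssentialParametersOn {ρ : ℕ} (f : ℝ × ℝ × (Fin ρ → ℝ) → ℝ)
    (V : Set (ℝ × ℝ × (Fin ρ → ℝ))) : Prop :=
  ¬ ∃ m : ℕ, m < ρ ∧
    ∃ (ζ : (Fin ρ → ℝ) → (Fin m → ℝ)) (g : ℝ × ℝ × (Fin m → ℝ) → ℝ)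
      (W : Set (ℝ × ℝ × (Fin m → ℝ))),
      IsOpen W ∧ ContDiffOn ℝ ∞ g W ∧
      ContDiffOn ℝ ∞ ζ ((fun p : ℝ × ℝ × (Fin ρ → ℝ) => p.2.2) '' V) ∧
      ∀ p ∈ V, (p.1, p.2.1, ζ p.2.2) ∈ W ∧ f p = g (p.1, p.2.1, ζ p.2.2)

/-! If `f` factors through fewer than `ρ` functions `ζ` of the parameters, then `dζ` has a nonzero
kernel vector at each parameter value. That vector is killed by the parameter gradients of all the
`f_i`, so the determinant vanishes (`det_paramJacobian_eq_zero_of_not_essential`).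

Conversely, let the determinant vanish at a regular point, and let `k < ρ` be maximal such that `L =
∂(f_0, …, f_{k-1})/∂κ` is onto there. Constancy of rank makes `∂f_k/∂κ` vanish on `ker L` nearby,
hence `‖∂f_k/∂κ w‖ ≤ K ‖L w‖` (`eventually_norm_le_of_ker_le`). So `Y = L w` satisfies `‖Y_x‖ ≤
max(1, K) ‖Y‖`, and by Grönwall `ker L` does not depend on `x`; its vectors kill the gradients of
all `f_n`. As `f_t` is a function of `t, x, f_0, …, f_r`, they also kill the gradient of `f_t`, and
of `∂_t f_i` after differentiating in `x`. A second Grönwall argument, in `t`, shows that `ker L`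
depends on `κ` only (`exists_ball_paramGrad_eq_zero`). With `t, x` frozen at the base point, `ζ =
(f_0, …, f_{k-1})` is a submersion whose kernels are killed by `∂f/∂κ`, so `f` factors locally
through these `k < ρ` functions (`exists_factorization`).

The density statement follows because regular points are dense (`exists_regular_point`). -/

/-! ### Commuting directional derivatives of smooth functions. -/

section DirectionalDerivative

variable {E : Type*} [NormedAddCommGroup E] [NormedSpace ℝ E]

/-- The directional derivative of `g` in the direction `a`. -/
noncomputable def dirDeriv (a : E) (g : E → ℝ) (p : E) : ℝ := fderiv ℝ g p a

theorem ContDiffOn.differentiableAt_of_isOpen {F G : Type*} [NormedAddCommGroup F]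
    [NormedSpace ℝ F] [NormedAddCommGroup G] [NormedSpace ℝ G] {g : F → G} {Ω : Set F}
    (hg : ContDiffOn ℝ ∞ g Ω) (hΩ : IsOpen Ω) {p : F} (hp : p ∈ Ω) : DifferentiableAt ℝ g p :=
  (hg.contDiffAt (hΩ.mem_nhds hp)).differentiableAt (by simp)

theorem contDiffOn_dirDeriv {Ω : Set E} (hΩ : IsOpen Ω) {g : E → ℝ} (hg : ContDiffOn ℝ ∞ g Ω)
    (a : E) : ContDiffOn ℝ ∞ (dirDeriv a g) Ω :=
  (hg.fderiv_of_isOpen hΩ (by simp)).clm_apply contDiffOn_const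

theorem dirDeriv_congr {Ω : Set E} (hΩ : IsOpen Ω) {g h : E → ℝ} (hgh : Set.EqOn g h Ω) (a : E) :
    Set.EqOn (dirDeriv a g) (dirDeriv a h) Ω := fun p hp => by
  unfold dirDeriv
  rw [(hgh.eventuallyEq_of_mem (hΩ.mem_nhds hp)).fderiv_eq]

theorem dirDeriv_comm {Ω : Set E} (hΩ : IsOpen Ω) {g : E → ℝ} (hg : ContDiffOn ℝ ∞ g Ω)
    (a b : E) : Set.EqOn (dirDeriv a (dirDeriv b g)) (dirDeriv b (dirDeriv a g)) Ω := by
  intro p hp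
  have hd : DifferentiableAt ℝ (fderiv ℝ g) p :=
    (hg.fderiv_of_isOpen hΩ (m := ∞) (by simp)).differentiableAt_of_isOpen hΩ hp
  have key : ∀ c d : E, dirDeriv c (dirDeriv d g) p = fderiv ℝ (fderiv ℝ g) p c d := by
    intro c d
    have := (hd.hasFDerivAt.clm_apply (hasFDerivAt_const d p)).fderiv
    unfold dirDeriv
    rw [this]
    simp
  rw [key, key]
  exact ((hg.contDiffAt (hΩ.mem_nhds hp)).isSymmSndFDerivAt
    (by simpa using WithTop.coe_le_coe.2 (le_top : (2 : ℕ∞) ≤ ⊤))) a b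

theorem contDiffOn_iterate_dirDeriv {Ω : Set E} (hΩ : IsOpen Ω) {g : E → ℝ}
    (hg : ContDiffOn ℝ ∞ g Ω) (a : E) (n : ℕ) : ContDiffOn ℝ ∞ ((dirDeriv a)^[n] g) Ω := by
  induction n with
  | zero => exact hg
  | succ n ih =>
    rw [Function.iterate_succ_apply']
    exact contDiffOn_dirDeriv hΩ ih a

theorem dirDeriv_iterate_comm {Ω : Set E} (hΩ : IsOpen Ω) {g : E → ℝ}
    (hg : ContDiffOn ℝ ∞ g Ω) (a b : E) (n : ℕ) :
    Set.EqOn (dirDeriv a ((dirDeriv b)^[n] g)) ((dirDeriv b)^[n] (dirDeriv a g)) Ω := by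
  induction n with
  | zero => exact fun _ _ => rfl
  | succ n ih =>
    rw [Function.iterate_succ_apply', Function.iterate_succ_apply']
    exact (dirDeriv_comm hΩ (contDiffOn_iterate_dirDeriv hΩ hg b n) a b).trans
      (dirDeriv_congr hΩ ih b)

end DirectionalDerivative

/-! ### Grönwall uniqueness and domination by a surjective linear map. -/

section GrowthAndKernels

variable {F : Type*} [NormedAddCommGroup F] [NormedSpace ℝ F]

/-- A solution of a linear differential inequality `‖Y'‖ ≤ K ‖Y‖` on an interval that vanishes
at one point vanishes identically. -/
theorem eq_zero_of_norm_deriv_le_mul_norm {Y Y' : ℝ → F} {K : ℝ} {I : Set ℝ}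
    (hI : I.OrdConnected) (hY : ∀ s ∈ I, HasDerivAt Y (Y' s) s)
    (hK : ∀ s ∈ I, ‖Y' s‖ ≤ K * ‖Y s‖) {a b : ℝ} (ha : a ∈ I) (hb : b ∈ I) (h0 : Y a = 0) :
    Y b = 0 := by
  rcases le_total a b with hab | hab
  · have hsub : Set.Icc a b ⊆ I := hI.out ha hb
    refine eq_zero_of_abs_deriv_le_mul_abs_self_of_eq_zero_right (f := Y) (f' := Y') (K := K)
      (a := a) (b := b) (fun s hs => (hY s (hsub hs)).continuousAt.continuousWithinAt)
      (fun s hs => (hY s (hsub ⟨hs.1, hs.2.le⟩)).hasDerivWithinAt) h0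
      (fun s hs => hK s (hsub ⟨hs.1, hs.2.le⟩)) b ⟨hab, le_rfl⟩
  · have hsub : ∀ s ∈ Set.Icc (-a) (-b), -s ∈ I := fun s hs =>
      hI.out hb ha ⟨by linarith [hs.2], by linarith [hs.1]⟩
    have hd : ∀ s ∈ Set.Icc (-a) (-b), HasDerivAt (fun s => Y (-s)) (-Y' (-s)) s := by
      intro s hs
      simpa [Function.comp_def] using (hY (-s) (hsub s hs)).scomp s (hasDerivAt_neg s)
    have := eq_zero_of_abs_deriv_le_mul_abs_self_of_eq_zero_right (f := fun s => Y (-s))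
      (f' := fun s => -Y' (-s)) (K := K)
      (a := -a) (b := -b) (fun s hs => (hd s hs).continuousAt.continuousWithinAt)
      (fun s hs => (hd s ⟨hs.1, hs.2.le⟩).hasDerivWithinAt) (by simpa using h0)
      (fun s hs => by simpa using hK (-s) (hsub s ⟨hs.1, hs.2.le⟩)) (-b) ⟨by linarith, le_rfl⟩
    simpa using this

/-- A continuous family of functionals that vanishes on the kernels of a continuous family of
linear maps, surjective at the base point, is locally dominated by this family. -/
theorem eventually_norm_le_of_ker_le {X G V : Type*} [TopologicalSpace X]
    [NormedAddCommGroup G] [NormedSpace ℝ G] [FiniteDimensional ℝ G]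
    [NormedAddCommGroup V] [NormedSpace ℝ V]
    {L : X → F →L[ℝ] G} {u : X → F →L[ℝ] V} {p : X} (hL : ContinuousAt L p)
    (hu : ContinuousAt u p) (hs : Function.Surjective (L p))
    (hker : ∀ᶠ q in 𝓝 p, ∀ w, L q w = 0 → u q w = 0) :
    ∃ K : ℝ, ∀ᶠ q in 𝓝 p, ∀ w, ‖u q w‖ ≤ K * ‖L q w‖ := by
  have : CompleteSpace G := FiniteDimensional.complete ℝ G
  obtain ⟨R0, hR0⟩ := (L p).toLinearMap.exists_rightInverse_of_surjective
    (LinearMap.range_eq_top.2 hs)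
  let R : G →L[ℝ] F := R0.toContinuousLinearMap
  have hR : (L p).comp R = 1 := by
    ext z
    exact LinearMap.congr_fun hR0 z
  have hLR : ContinuousAt (fun q => (L q).comp R) p := hL.clm_comp continuousAt_const
  have hinv : ContinuousAt (fun q => Ring.inverse ((L q).comp R)) p := by
    have h1 : ContinuousAt Ring.inverse ((L p).comp R) := by
      rw [hR]; exact NormedRing.inverse_continuousAt 1
    exact ContinuousAt.comp (f := fun q => (L q).comp R) h1 hLR
  have hunit : ∀ᶠ q in 𝓝 p, IsUnit ((L q).comp R) := by
    refine hLR.eventually ?_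
    simp only [hR]
    exact Units.isOpen.mem_nhds isUnit_one
  have hc : ContinuousAt (fun q => ‖(u q).comp (R.comp (Ring.inverse ((L q).comp R)))‖) p :=
    (hu.clm_comp (continuousAt_const.clm_comp hinv)).norm
  refine ⟨‖(u p).comp (R.comp (Ring.inverse ((L p).comp R)))‖ + 1, ?_⟩
  filter_upwards [hker, hunit, hc.eventually_lt continuousAt_const (lt_add_one _)]
    with q hq hqu hqK w
  -- `R (L R)⁻¹` is a right inverse of `L` that is continuous at `p`; since `u` kills the difference
  -- below, `u w = u R (L R)⁻¹ (L w)`.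
  have h1 : L q (w - R (Ring.inverse ((L q).comp R) (L q w))) = 0 := by
    have := DFunLike.congr_fun (Ring.mul_inverse_cancel _ hqu) (L q w)
    simp only [mul_apply_eq_comp, ContinuousLinearMap.comp_apply,
      one_apply_eq_self] at this
    rw [map_sub, this, sub_self]
  have h2 := hq _ h1
  rw [map_sub, sub_eq_zero] at h2
  rw [h2]
  calc _ ≤ ‖(u q).comp (R.comp (Ring.inverse ((L q).comp R)))‖ * ‖L q w‖ :=
        ContinuousLinearMap.le_opNorm ((u q).comp (R.comp (Ring.inverse ((L q).comp R)))) (L q w)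
    _ ≤ _ := by gcongr

end GrowthAndKernels

/-! ### Partial derivatives and parameter gradients along coordinate lines. -/

section ParameterGradients

variable {ρ : ℕ}

/-- The gradient of `g(t, x, κ)` with respect to the parameters `κ`. -/
noncomputable def paramGrad (g : ℝ × ℝ × (Fin ρ → ℝ) → ℝ) (q : ℝ × ℝ × (Fin ρ → ℝ)) :
    (Fin ρ → ℝ) →L[ℝ] ℝ :=
  (fderiv ℝ g q).comp
    ((ContinuousLinearMap.inr ℝ ℝ (ℝ × (Fin ρ → ℝ))).comp
      (ContinuousLinearMap.inr ℝ ℝ (Fin ρ → ℝ)))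

theorem paramGrad_apply (g : ℝ × ℝ × (Fin ρ → ℝ) → ℝ) (q : ℝ × ℝ × (Fin ρ → ℝ))
    (w : Fin ρ → ℝ) : paramGrad g q w = dirDeriv (0, 0, w) g q := rfl

theorem continuousOn_paramGrad {Ω : Set (ℝ × ℝ × (Fin ρ → ℝ))} (hΩ : IsOpen Ω)
    {g : ℝ × ℝ × (Fin ρ → ℝ) → ℝ} (hg : ContDiffOn ℝ ∞ g Ω) : ContinuousOn (paramGrad g) Ω :=
  ((hg.fderiv_of_isOpen hΩ (m := ∞) (by simp)).continuousOn).clm_comp continuousOn_const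

theorem continuousOn_clm_pi {X ι : Type*} [TopologicalSpace X] [Fintype ι] {S : Set X}
    {l : X → ι → (Fin ρ → ℝ) →L[ℝ] ℝ} (h : ∀ i, ContinuousOn (fun q => l q i) S) :
    ContinuousOn (fun q => ContinuousLinearMap.pi (l q)) S :=
  continuousOn_clm_apply.2 fun w => continuousOn_pi.2 fun i =>
    continuousOn_clm_apply.1 (h i) w

theorem hasDerivAt_xLine (t y : ℝ) (κ : Fin ρ → ℝ) :
    HasDerivAt (fun s : ℝ => ((t, s, κ) : ℝ × ℝ × (Fin ρ → ℝ))) (0, 1, 0) y :=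
  (hasDerivAt_const y t).prodMk ((hasDerivAt_id y).prodMk (hasDerivAt_const y κ))

theorem hasDerivAt_tLine (t y : ℝ) (κ : Fin ρ → ℝ) :
    HasDerivAt (fun s : ℝ => ((s, y, κ) : ℝ × ℝ × (Fin ρ → ℝ))) (1, 0, 0) t :=
  (hasDerivAt_id t).prodMk ((hasDerivAt_const t y).prodMk (hasDerivAt_const t κ))

theorem hasFDerivAt_paramSlice (t y : ℝ) (κ : Fin ρ → ℝ) :
    HasFDerivAt (fun κ' : Fin ρ → ℝ => ((t, y, κ') : ℝ × ℝ × (Fin ρ → ℝ)))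
      ((ContinuousLinearMap.inr ℝ ℝ (ℝ × (Fin ρ → ℝ))).comp
        (ContinuousLinearMap.inr ℝ ℝ (Fin ρ → ℝ))) κ :=
  (hasFDerivAt_prodMk_right t (y, κ)).comp κ (hasFDerivAt_prodMk_right y κ)

theorem hasDerivAt_comp_xLine {g : ℝ × ℝ × (Fin ρ → ℝ) → ℝ} {t y : ℝ} {κ : Fin ρ → ℝ}
    (hg : DifferentiableAt ℝ g (t, y, κ)) :
    HasDerivAt (fun s => g (t, s, κ)) (dirDeriv (0, 1, 0) g (t, y, κ)) y :=
  hg.hasFDerivAt.comp_hasDerivAt y (hasDerivAt_xLine t y κ)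

theorem hasDerivAt_comp_tLine {g : ℝ × ℝ × (Fin ρ → ℝ) → ℝ} {t y : ℝ} {κ : Fin ρ → ℝ}
    (hg : DifferentiableAt ℝ g (t, y, κ)) :
    HasDerivAt (fun s => g (s, y, κ)) (dirDeriv (1, 0, 0) g (t, y, κ)) t :=
  hg.hasFDerivAt.comp_hasDerivAt t (hasDerivAt_tLine t y κ)

theorem hasFDerivAt_comp_paramSlice {g : ℝ × ℝ × (Fin ρ → ℝ) → ℝ} {t y : ℝ} {κ : Fin ρ → ℝ}
    (hg : DifferentiableAt ℝ g (t, y, κ)) :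
    HasFDerivAt (fun κ' => g (t, y, κ')) (paramGrad g (t, y, κ)) κ :=
  hg.hasFDerivAt.comp κ (hasFDerivAt_paramSlice t y κ)

theorem xDeriv_eqOn {Ω : Set (ℝ × ℝ × (Fin ρ → ℝ))} (hΩ : IsOpen Ω)
    {f : ℝ × ℝ × (Fin ρ → ℝ) → ℝ} (hf : ContDiffOn ℝ ∞ f Ω) (k : ℕ) :
    Set.EqOn (xDeriv f k) ((dirDeriv (0, 1, 0))^[k] f) Ω := by
  induction k with
  | zero => intro p _; simp [xDeriv]
  | succ k ih =>
    rintro ⟨t, x, κ⟩ hp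
    have h1 : xDeriv f (k + 1) (t, x, κ) = deriv (fun y => xDeriv f k (t, y, κ)) x := by
      simp only [xDeriv, iteratedDeriv_succ]
    have h2 : (fun y => xDeriv f k (t, y, κ)) =ᶠ[𝓝 x]
        fun y => (dirDeriv (0, 1, 0))^[k] f (t, y, κ) :=
      ((hasDerivAt_xLine t x κ).continuousAt.eventually (hΩ.mem_nhds hp)).mono fun y hy => ih hy
    rw [h1, h2.deriv_eq, Function.iterate_succ_apply']
    exact (hasDerivAt_comp_xLine
      ((contDiffOn_iterate_dirDeriv hΩ hf _ k).differentiableAt_of_isOpen hΩ hp)).deriv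

theorem contDiffOn_xDeriv {Ω : Set (ℝ × ℝ × (Fin ρ → ℝ))} (hΩ : IsOpen Ω)
    {f : ℝ × ℝ × (Fin ρ → ℝ) → ℝ} (hf : ContDiffOn ℝ ∞ f Ω) (k : ℕ) :
    ContDiffOn ℝ ∞ (xDeriv f k) Ω :=
  (contDiffOn_iterate_dirDeriv hΩ hf _ k).congr (xDeriv_eqOn hΩ hf k)

theorem tDeriv_eqOn {Ω : Set (ℝ × ℝ × (Fin ρ → ℝ))} (hΩ : IsOpen Ω)
    {f : ℝ × ℝ × (Fin ρ → ℝ) → ℝ} (hf : ContDiffOn ℝ ∞ f Ω) :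
    Set.EqOn (tDeriv f) (dirDeriv (1, 0, 0) f) Ω := by
  rintro ⟨t, x, κ⟩ hp
  exact (hasDerivAt_comp_tLine (hf.differentiableAt_of_isOpen hΩ hp)).deriv

theorem paramGrad_congr {Ω : Set (ℝ × ℝ × (Fin ρ → ℝ))} (hΩ : IsOpen Ω)
    {g h : ℝ × ℝ × (Fin ρ → ℝ) → ℝ} (hgh : Set.EqOn g h Ω) :
    Set.EqOn (paramGrad g) (paramGrad h) Ω := fun p hp => by
  unfold paramGrad
  rw [(hgh.eventuallyEq_of_mem (hΩ.mem_nhds hp)).fderiv_eq]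

/-- The differential of `κ ↦ (f_0, …, f_{k-1})(t, x, κ)`. -/
noncomputable def paramGradMap (f : ℝ × ℝ × (Fin ρ → ℝ) → ℝ) (k : ℕ)
    (q : ℝ × ℝ × (Fin ρ → ℝ)) : (Fin ρ → ℝ) →L[ℝ] (Fin k → ℝ) :=
  ContinuousLinearMap.pi fun i : Fin k => paramGrad (xDeriv f i) q

theorem paramGradMap_eq_zero_iff (f : ℝ × ℝ × (Fin ρ → ℝ) → ℝ) (k : ℕ)
    (q : ℝ × ℝ × (Fin ρ → ℝ)) (w : Fin ρ → ℝ) :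
    paramGradMap f k q w = 0 ↔ ∀ i < k, paramGrad (xDeriv f i) q w = 0 := by
  rw [funext_iff]
  exact ⟨fun h i hi => h ⟨i, hi⟩, fun h i => h i i.2⟩

theorem continuousOn_paramGradMap {Ω : Set (ℝ × ℝ × (Fin ρ → ℝ))} (hΩ : IsOpen Ω)
    {f : ℝ × ℝ × (Fin ρ → ℝ) → ℝ} (hf : ContDiffOn ℝ ∞ f Ω) (k : ℕ) :
    ContinuousOn (paramGradMap f k) Ω := by
  exact continuousOn_clm_pi fun i => continuousOn_paramGrad hΩ (contDiffOn_xDeriv hΩ hf i)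

theorem toLin'_paramJacobian {Ω : Set (ℝ × ℝ × (Fin ρ → ℝ))} (hΩ : IsOpen Ω)
    {f : ℝ × ℝ × (Fin ρ → ℝ) → ℝ} (hf : ContDiffOn ℝ ∞ f Ω) (k : ℕ)
    {q : ℝ × ℝ × (Fin ρ → ℝ)} (hq : q ∈ Ω) :
    Matrix.toLin' (paramJacobian f k q) = (paramGradMap f k q : (Fin ρ → ℝ) →ₗ[ℝ] (Fin k → ℝ)) := by
  refine LinearMap.pi_ext' fun b => LinearMap.ext_ring ?_
  ext a
  obtain ⟨t, x, κ⟩ := q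
  have h := (hasFDerivAt_comp_paramSlice
    ((contDiffOn_xDeriv hΩ hf a).differentiableAt_of_isOpen hΩ hq)).fderiv
  simp only [LinearMap.comp_apply, LinearMap.single_apply, Matrix.toLin'_apply,
    Matrix.mulVec_single_one, Matrix.col_apply, paramJacobian, Matrix.of_apply]
  rw [h]
  rfl

theorem rank_paramJacobian {Ω : Set (ℝ × ℝ × (Fin ρ → ℝ))} (hΩ : IsOpen Ω)
    {f : ℝ × ℝ × (Fin ρ → ℝ) → ℝ} (hf : ContDiffOn ℝ ∞ f Ω) (k : ℕ)
    {q : ℝ × ℝ × (Fin ρ → ℝ)} (hq : q ∈ Ω) :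
    (paramJacobian f k q).rank =
      Module.finrank ℝ (paramGradMap f k q : (Fin ρ → ℝ) →ₗ[ℝ] (Fin k → ℝ)).range := by
  rw [← toLin'_paramJacobian hΩ hf k hq, Matrix.rank]
  rfl

end ParameterGradients

/-! ### Independence of the kernels from `x` and `t`. -/

section InvariantKernels

variable {ρ : ℕ} {Ω : Set (ℝ × ℝ × (Fin ρ → ℝ))} {f : ℝ × ℝ × (Fin ρ → ℝ) → ℝ}

theorem mem_ball_prod_iff {p q : ℝ × ℝ × (Fin ρ → ℝ)} {ε : ℝ} :
    q ∈ Metric.ball p ε ↔ q.1 ∈ Metric.ball p.1 ε ∧ q.2.1 ∈ Metric.ball p.2.1 ε ∧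
      q.2.2 ∈ Metric.ball p.2.2 ε := by
  simp only [Metric.mem_ball, Prod.dist_eq, max_lt_iff]

theorem dirDeriv_xDeriv (hΩ : IsOpen Ω) (hf : ContDiffOn ℝ ∞ f Ω) (i : ℕ) :
    Set.EqOn (dirDeriv (0, 1, 0) (xDeriv f i)) (xDeriv f (i + 1)) Ω := by
  intro q hq
  rw [dirDeriv_congr hΩ (xDeriv_eqOn hΩ hf i) _ hq, xDeriv_eqOn hΩ hf (i + 1) hq,
    Function.iterate_succ_apply']

theorem dirDeriv_param_comm (hΩ : IsOpen Ω) {g : ℝ × ℝ × (Fin ρ → ℝ) → ℝ}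
    (hg : ContDiffOn ℝ ∞ g Ω) (a : ℝ × ℝ × (Fin ρ → ℝ)) (w : Fin ρ → ℝ)
    {q : ℝ × ℝ × (Fin ρ → ℝ)} (hq : q ∈ Ω) :
    dirDeriv a (fun q => paramGrad g q w) q = paramGrad (dirDeriv a g) q w :=
  dirDeriv_comm hΩ hg a (0, 0, w) hq

theorem contDiffOn_paramGrad_apply (hΩ : IsOpen Ω) {g : ℝ × ℝ × (Fin ρ → ℝ) → ℝ}
    (hg : ContDiffOn ℝ ∞ g Ω) (w : Fin ρ → ℝ) :
    ContDiffOn ℝ ∞ (fun q => paramGrad g q w) Ω :=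
  contDiffOn_dirDeriv hΩ hg (0, 0, w)

theorem hasDerivAt_paramGradMap_xLine (hΩ : IsOpen Ω) (hf : ContDiffOn ℝ ∞ f Ω) (k : ℕ)
    (w : Fin ρ → ℝ) {t y : ℝ} {κ : Fin ρ → ℝ} (hq : (t, y, κ) ∈ Ω) :
    HasDerivAt (fun s => paramGradMap f k (t, s, κ) w)
      (fun i : Fin k => paramGrad (xDeriv f (i + 1)) (t, y, κ) w) y := by
  refine hasDerivAt_pi.2 fun i => ?_
  have h := hasDerivAt_comp_xLine ((contDiffOn_paramGrad_apply hΩ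
    (contDiffOn_xDeriv hΩ hf i) w).differentiableAt_of_isOpen hΩ hq)
  rw [dirDeriv_param_comm hΩ (contDiffOn_xDeriv hΩ hf i) _ _ hq,
    paramGrad_congr hΩ (dirDeriv_xDeriv hΩ hf i) hq] at h
  exact h

theorem hasDerivAt_paramGradMap_tLine (hΩ : IsOpen Ω) (hf : ContDiffOn ℝ ∞ f Ω) (k : ℕ)
    (w : Fin ρ → ℝ) {t y : ℝ} {κ : Fin ρ → ℝ} (hq : (t, y, κ) ∈ Ω) :
    HasDerivAt (fun s => paramGradMap f k (s, y, κ) w)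
      (fun i : Fin k => paramGrad (dirDeriv (1, 0, 0) (xDeriv f i)) (t, y, κ) w) t := by
  refine hasDerivAt_pi.2 fun i => ?_
  have h := hasDerivAt_comp_tLine ((contDiffOn_paramGrad_apply hΩ
    (contDiffOn_xDeriv hΩ hf i) w).differentiableAt_of_isOpen hΩ hq)
  rw [dirDeriv_param_comm hΩ (contDiffOn_xDeriv hΩ hf i) _ _ hq] at h
  exact h

/-- If a smooth function vanishes along an `x`-line, so do all its `x`-derivatives. -/
theorem iterate_dirDeriv_eq_zero_of_xLine (hΩ : IsOpen Ω) {g : ℝ × ℝ × (Fin ρ → ℝ) → ℝ}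
    (hg : ContDiffOn ℝ ∞ g Ω) {t : ℝ} {κ : Fin ρ → ℝ} (h0 : ∀ y, (t, y, κ) ∈ Ω → g (t, y, κ) = 0)
    (n : ℕ) : ∀ y, (t, y, κ) ∈ Ω → (dirDeriv (0, 1, 0))^[n] g (t, y, κ) = 0 := by
  induction n with
  | zero => exact h0
  | succ n ih =>
    intro y hy
    rw [Function.iterate_succ_apply']
    have h1 := hasDerivAt_comp_xLine
      ((contDiffOn_iterate_dirDeriv hΩ hg (0, 1, 0) n).differentiableAt_of_isOpen hΩ hy)
    have h2 : (fun s => (dirDeriv (0, 1, 0))^[n] g (t, s, κ)) =ᶠ[𝓝 y] fun _ => 0 :=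
      ((hasDerivAt_xLine t y κ).continuousAt.eventually (hΩ.mem_nhds hy)).mono fun s hs => ih s hs
    exact (h1.congr_of_eventuallyEq h2.symm).unique (hasDerivAt_const y 0)

/-- The fixed direction `w` lets `∂_x^n` commute with the derivative along `w`. This is used both
for `f` and for `f_t`. -/
theorem paramGrad_xDeriv_eq_zero_of_xLine {B : Set (ℝ × ℝ × (Fin ρ → ℝ))} (hB : IsOpen B)
    (hf : ContDiffOn ℝ ∞ f B) {t : ℝ} {κ : Fin ρ → ℝ} {w : Fin ρ → ℝ}
    (h0 : ∀ y, (t, y, κ) ∈ B → paramGrad f (t, y, κ) w = 0) (n : ℕ) :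
    ∀ y, (t, y, κ) ∈ B → paramGrad (xDeriv f n) (t, y, κ) w = 0 := by
  intro y hy
  rw [paramGrad_congr hB (xDeriv_eqOn hB hf n) hy, paramGrad_apply,
    dirDeriv_iterate_comm hB hf _ _ n hy]
  exact iterate_dirDeriv_eq_zero_of_xLine hB (contDiffOn_dirDeriv hB hf _) h0 n y hy

/-- If `∂f_k/∂κ` is dominated by `∂(f_0, …, f_{k-1})/∂κ`, then the kernel of the latter is
constant in `x`, and it annihilates the parameter gradients of all `f_n`. -/
theorem paramGrad_xDeriv_eq_zero_of_bound {p : ℝ × ℝ × (Fin ρ → ℝ)} {ε K : ℝ} {k : ℕ}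
    (hf : ContDiffOn ℝ ∞ f (Metric.ball p ε))
    (hb : ∀ q ∈ Metric.ball p ε, ∀ w,
      ‖paramGrad (xDeriv f k) q w‖ ≤ K * ‖paramGradMap f k q w‖)
    {t x y : ℝ} {κ w : Fin ρ → ℝ} (hx : (t, x, κ) ∈ Metric.ball p ε)
    (hy : (t, y, κ) ∈ Metric.ball p ε) (hw : paramGradMap f k (t, x, κ) w = 0) (n : ℕ) :
    paramGrad (xDeriv f n) (t, y, κ) w = 0 := by
  have hline : ∀ s, s ∈ Metric.ball p.2.1 ε → (t, s, κ) ∈ Metric.ball p ε := fun s hs =>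
    mem_ball_prod_iff.2 ⟨(mem_ball_prod_iff.1 hx).1, hs, (mem_ball_prod_iff.1 hx).2.2⟩
  have hzero : ∀ s, (t, s, κ) ∈ Metric.ball p ε → paramGradMap f k (t, s, κ) w = 0 := by
    intro s hs
    -- Differentiating in `x` shifts the components of `Y`: all but the last derivative are again
    -- components of `Y` (constant `1`), and the last is `∂f_k/∂κ w` (constant `K`).
    refine eq_zero_of_norm_deriv_le_mul_norm (Y := fun s => paramGradMap f k (t, s, κ) w)
      (K := max 1 K) (convex_ball p.2.1 ε).ordConnected
      (fun s hs => hasDerivAt_paramGradMap_xLine Metric.isOpen_ball hf k w (hline s hs))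
      (fun s hs => ?_) (mem_ball_prod_iff.1 hx).2.1 (mem_ball_prod_iff.1 hs).2.1 hw
    refine (pi_norm_le_iff_of_nonneg (by positivity)).2 fun i => ?_
    rcases (Nat.succ_le_of_lt i.2).lt_or_eq with hi | hi
    · calc ‖paramGrad (xDeriv f (i + 1)) (t, s, κ) w‖
          = ‖paramGradMap f k (t, s, κ) w ⟨i + 1, hi⟩‖ := rfl
        _ ≤ 1 * ‖paramGradMap f k (t, s, κ) w‖ := by
            rw [one_mul]; exact norm_le_pi_norm _ _
        _ ≤ _ := by gcongr; exact le_max_left _ _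
    · have : (i : ℕ) + 1 = k := hi
      rw [this]
      refine (hb _ (hline s hs) w).trans ?_
      gcongr; exact le_max_right _ _
  have h0 : ∀ s, (t, s, κ) ∈ Metric.ball p ε → paramGrad (xDeriv f 0) (t, s, κ) w = 0 := by
    intro s hs
    -- For `k = 0` the vector `Y` is empty, and the bound itself says that the gradient of `f_0`
    -- vanishes.
    rcases Nat.eq_zero_or_pos k with rfl | hk
    · have h := hb _ hs w
      rw [hzero s hs, norm_zero, mul_zero] at h
      exact norm_le_zero_iff.1 h
    · exact (paramGradMap_eq_zero_iff f k _ w).1 (hzero s hs) 0 hk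
  refine paramGrad_xDeriv_eq_zero_of_xLine Metric.isOpen_ball hf (fun s hs => ?_) n y hy
  have h := h0 s hs
  rwa [paramGrad_congr Metric.isOpen_ball (xDeriv_eqOn Metric.isOpen_ball hf 0) hs] at h

/-- Two Grönwall arguments carry a kernel vector from the base values of `t, x` to nearby ones:
first along `t` at the base `x`, then along `x`. The hypothesis `ht` is the only trace of the
evolution equation. -/
theorem exists_ball_paramGrad_eq_zero (hΩ : IsOpen Ω) (hf : ContDiffOn ℝ ∞ f Ω)
    {p : ℝ × ℝ × (Fin ρ → ℝ)} (hp : p ∈ Ω) {k : ℕ}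
    (hsurj : Function.Surjective (paramGradMap f k p))
    (hker : ∀ᶠ q in 𝓝 p, ∀ w, paramGradMap f k q w = 0 → paramGrad (xDeriv f k) q w = 0)
    (ht : ∀ q ∈ Ω, ∀ w, (∀ n, paramGrad (xDeriv f n) q w = 0) →
      paramGrad (dirDeriv (1, 0, 0) f) q w = 0) :
    ∃ ε > 0, Metric.ball p ε ⊆ Ω ∧ ∀ q ∈ Metric.ball p ε, ∀ w,
      paramGradMap f k (p.1, p.2.1, q.2.2) w = 0 → paramGrad f q w = 0 := by
  have hΩp := hΩ.mem_nhds hp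
  have hL := (continuousOn_paramGradMap hΩ hf k).continuousAt hΩp
  obtain ⟨K, hKe⟩ := eventually_norm_le_of_ker_le hL
    ((continuousOn_paramGrad hΩ (contDiffOn_xDeriv hΩ hf k)).continuousAt hΩp) hsurj hker
  obtain ⟨ε₁, hε₁, hB₁⟩ := Metric.eventually_nhds_iff_ball.1 (hKe.and hΩp)
  have hfB : ContDiffOn ℝ ∞ f (Metric.ball p ε₁) := hf.mono fun q hq => (hB₁ q hq).2
  have hall := @paramGrad_xDeriv_eq_zero_of_bound ρ f p ε₁ K k hfB fun q hq => (hB₁ q hq).1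
  -- This is the `t`-derivative of `paramGradMap f k`; dominating it by `paramGradMap f k` gives the
  -- differential inequality in `t`.
  let u : ℝ × ℝ × (Fin ρ → ℝ) → (Fin ρ → ℝ) →L[ℝ] (Fin k → ℝ) := fun q =>
    ContinuousLinearMap.pi fun i : Fin k => paramGrad (dirDeriv (1, 0, 0) (xDeriv f i)) q
  have hu : ContinuousAt u p :=
    (continuousOn_clm_pi fun i : Fin k => continuousOn_paramGrad hΩ
      (contDiffOn_dirDeriv hΩ (contDiffOn_xDeriv hΩ hf i) _)).continuousAt hΩp
  have hB := Metric.isOpen_ball (x := p) (ε := ε₁)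
  have hukerB : ∀ q ∈ Metric.ball p ε₁, ∀ w, paramGradMap f k q w = 0 → u q w = 0 := by
    rintro ⟨t, x, κ⟩ hq w hw
    funext i
    change paramGrad (dirDeriv (1, 0, 0) (xDeriv f i)) (t, x, κ) w = 0
    -- Since `∂_t ∂_x^i f = ∂_x^i f_t`, it suffices that `w` kills the gradient of `f_t` along the
    -- whole `x`-line.
    have e1 : Set.EqOn (dirDeriv (1, 0, 0) (xDeriv f i))
        ((dirDeriv (0, 1, 0))^[i] (dirDeriv (1, 0, 0) f)) (Metric.ball p ε₁) :=
      (dirDeriv_congr hB (xDeriv_eqOn hB hfB i) _).trans (dirDeriv_iterate_comm hB hfB _ _ i)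
    have hft := contDiffOn_dirDeriv hB hfB (1, 0, 0)
    rw [paramGrad_congr hB (e1.trans (xDeriv_eqOn hB hft i).symm) hq]
    exact paramGrad_xDeriv_eq_zero_of_xLine hB hft
      (fun y hy => ht _ (hB₁ _ hy).2 w fun n => hall hq hy hw n) i x hq
  obtain ⟨K', hKe'⟩ := eventually_norm_le_of_ker_le hL hu hsurj
    (Filter.eventually_of_mem (Metric.ball_mem_nhds p hε₁) hukerB)
  obtain ⟨ε, hε, hB₂⟩ := Metric.eventually_nhds_iff_ball.1
    (hKe'.and (Metric.ball_mem_nhds p hε₁))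
  refine ⟨ε, hε, fun q hq => (hB₁ q (hB₂ q hq).2).2, ?_⟩
  rintro ⟨t, x, κ⟩ hq w hw
  obtain ⟨h1, h2, h3⟩ := mem_ball_prod_iff.1 hq
  have hc : p.2.1 ∈ Metric.ball p.2.1 ε := Metric.mem_ball_self hε
  have hline : ∀ s, s ∈ Metric.ball p.1 ε → (s, p.2.1, κ) ∈ Metric.ball p ε := fun s hs =>
    mem_ball_prod_iff.2 ⟨hs, hc, h3⟩
  have hT : paramGradMap f k (t, p.2.1, κ) w = 0 :=
    eq_zero_of_norm_deriv_le_mul_norm (Y := fun s => paramGradMap f k (s, p.2.1, κ) w)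
      (convex_ball p.1 ε).ordConnected
      (fun s hs => hasDerivAt_paramGradMap_tLine hB hfB k w (hB₂ _ (hline s hs)).2)
      (fun s hs => (hB₂ _ (hline s hs)).1 w) (Metric.mem_ball_self hε) h1 hw
  have := hall (hB₂ _ (hline t h1)).2 (hB₂ _ hq).2 hT 0
  rwa [paramGrad_congr hB (xDeriv_eqOn hB hfB 0) (hB₂ _ hq).2] at this

end InvariantKernels

/-! ### Local factorization through a submersion. -/

section LocalFactorization

variable {ρ k : ℕ}

/-- A smooth map with surjective differential is locally the composition of a diffeomorphism with
a linear surjection. -/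
theorem exists_straightening {E F : Type*} [NormedAddCommGroup E] [NormedSpace ℝ E]
    [FiniteDimensional ℝ E] [NormedAddCommGroup F] [NormedSpace ℝ F] [FiniteDimensional ℝ F]
    {ζ : E → F} {U : Set E} (hU : IsOpen U) (hζ : ContDiffOn ℝ ∞ ζ U) {c : E} (hc : c ∈ U)
    (hs : Function.Surjective (fderiv ℝ ζ c)) :
    ∃ (L : E →L[ℝ] F) (R : F →L[ℝ] E) (Φ : OpenPartialHomeomorph E E),
      (∀ z, L (R z) = z) ∧ c ∈ Φ.source ∧ Φ.source ⊆ U ∧ (∀ e ∈ Φ.source, L (Φ e) = ζ e) ∧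
      ContDiffOn ℝ ∞ Φ.symm Φ.target := by
  have : CompleteSpace E := FiniteDimensional.complete ℝ E
  set L := fderiv ℝ ζ c with hL
  obtain ⟨R0, hR0⟩ := L.toLinearMap.exists_rightInverse_of_surjective
    (LinearMap.range_eq_top.2 hs)
  let R : F →L[ℝ] E := R0.toContinuousLinearMap
  have hLR : ∀ z, L (R z) = z := fun z => LinearMap.congr_fun hR0 z
  -- From `L R = 1` one gets `L ∘ φ = ζ`, and the differential of `φ` at `c` is `R L + 1 - R L = 1`.
  let φ : E → E := fun e => R (ζ e) + (e - R (L e))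
  have hφ : ContDiffOn ℝ ∞ φ U :=
    (R.contDiff.comp_contDiffOn hζ).add
      (contDiffOn_id.sub (R.contDiff.comp L.contDiff).contDiffOn)
  have hφc : ContDiffAt ℝ ∞ φ c := hφ.contDiffAt (hU.mem_nhds hc)
  have hd : HasFDerivAt φ ((ContinuousLinearEquiv.refl ℝ E : E ≃L[ℝ] E) : E →L[ℝ] E) c := by
    have h1 := (R.hasFDerivAt.comp c (hζ.differentiableAt_of_isOpen hU hc).hasFDerivAt).add
      ((hasFDerivAt_id c).sub (R.hasFDerivAt.comp c L.hasFDerivAt))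
    refine h1.congr_fderiv ?_
    ext e
    simp [hL]
  let Φ₀ := hφc.toOpenPartialHomeomorph φ hd (by simp)
  have hcs : c ∈ Φ₀.source := hφc.mem_toOpenPartialHomeomorph_source hd (by simp)
  -- Restricting to points with invertible differential makes the inverse smooth on the whole
  -- target, not only at the image of `c`.
  let S : Set E := U ∩ (fderiv ℝ φ) ⁻¹' {A | IsUnit A}
  have hS : IsOpen S :=
    (hφ.continuousOn_fderiv_of_isOpen hU (by simp)).isOpen_inter_preimage hU Units.isOpen
  have hcS : c ∈ S := by
    refine ⟨hc, ?_⟩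
    rw [Set.mem_preimage, hd.fderiv]
    exact isUnit_one
  let Φ := Φ₀.restrOpen S hS
  have hΦ : ∀ e, Φ e = φ e := fun e => rfl
  have hsrc : ∀ e ∈ Φ.source, e ∈ S := fun e he => he.2
  refine ⟨L, R, Φ, hLR, ⟨hcs, hcS⟩, fun e he => (hsrc e he).1, fun e _ => ?_, fun y hy => ?_⟩
  · rw [hΦ]
    simp only [φ, map_add, map_sub, hLR]
    abel
  · have he := Φ.map_target hy
    obtain ⟨heU, A, hA⟩ := hsrc _ he
    refine (Φ.contDiffAt_symm (f₀' := ContinuousLinearEquiv.unitsEquiv ℝ E A) hy ?_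
      (hφ.contDiffAt (hU.mem_nhds heU))).contDiffWithinAt
    have := (hφ.differentiableAt_of_isOpen hU heU).hasFDerivAt
    rw [← hA] at this
    exact this

/-- A function whose parameter gradient annihilates the kernel of the differential of a submersion
`ζ` depends on the parameters locally only through `ζ`. -/
theorem exists_factorization {f : ℝ × ℝ × (Fin ρ → ℝ) → ℝ} {p : ℝ × ℝ × (Fin ρ → ℝ)} {ε : ℝ}
    (hε : 0 < ε) (hf : ContDiffOn ℝ ∞ f (Metric.ball p ε)) {ζ : (Fin ρ → ℝ) → (Fin k → ℝ)}
    (hζ : ContDiffOn ℝ ∞ ζ (Metric.ball p.2.2 ε)) (hs : Function.Surjective (fderiv ℝ ζ p.2.2))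
    (hker : ∀ q ∈ Metric.ball p ε, ∀ w, fderiv ℝ ζ q.2.2 w = 0 → paramGrad f q w = 0) :
    ∃ (V : Set (ℝ × ℝ × (Fin ρ → ℝ))) (g : ℝ × ℝ × (Fin k → ℝ) → ℝ)
      (W : Set (ℝ × ℝ × (Fin k → ℝ))), IsOpen V ∧ p ∈ V ∧ V ⊆ Metric.ball p ε ∧ IsOpen W ∧
      ContDiffOn ℝ ∞ g W ∧
      ∀ q ∈ V, (q.1, q.2.1, ζ q.2.2) ∈ W ∧ f q = g (q.1, q.2.1, ζ q.2.2) := by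
  obtain ⟨L, R, Φ, hLR, hcs, hsU, hΦ, hΨ⟩ := exists_straightening Metric.isOpen_ball hζ
    (Metric.mem_ball_self hε) hs
  set e₀ := Φ p.2.2 with he₀
  obtain ⟨δ, hδ, hδT⟩ := Metric.isOpen_iff.1 Φ.open_target e₀ (Φ.map_source hcs)
  have hΨU : ∀ e ∈ Metric.ball e₀ δ, Φ.symm e ∈ Metric.ball p.2.2 ε := fun e he =>
    hsU (Φ.map_target (hδT he))
  have hΨδ : ContDiffOn ℝ ∞ Φ.symm (Metric.ball e₀ δ) := hΨ.mono hδT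
  have hmem : ∀ t ∈ Metric.ball p.1 ε, ∀ x ∈ Metric.ball p.2.1 ε, ∀ e ∈ Metric.ball e₀ δ,
      (t, x, Φ.symm e) ∈ Metric.ball p ε := fun t ht x hx e he =>
    mem_ball_prod_iff.2 ⟨ht, hx, hΨU e he⟩
  have hζΨ : ∀ e ∈ Metric.ball e₀ δ, ζ (Φ.symm e) = L e := fun e he => by
    rw [← hΦ _ (Φ.map_target (hδT he)), Φ.right_inv (hδT he)]
  -- An affine section of `L` through `e₀`: `L (σ z) = z` and `σ (L e₀) = e₀`.
  let σ : (Fin k → ℝ) → (Fin ρ → ℝ) := fun z => e₀ + R (z - L e₀)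
  have hσ : ContDiff ℝ ∞ σ := contDiff_const.add (R.contDiff.comp (contDiff_id.sub contDiff_const))
  let W : Set (ℝ × ℝ × (Fin k → ℝ)) :=
    {z | z.1 ∈ Metric.ball p.1 ε ∧ z.2.1 ∈ Metric.ball p.2.1 ε ∧ σ z.2.2 ∈ Metric.ball e₀ δ}
  have hW : IsOpen W :=
    (Metric.isOpen_ball.preimage continuous_fst).inter
      ((Metric.isOpen_ball.preimage (continuous_fst.comp continuous_snd)).inter
        (Metric.isOpen_ball.preimage (hσ.continuous.comp (continuous_snd.comp continuous_snd))))
  -- In straightened coordinates `ζ` becomes `L`. The segment joining two points of an `L`-fibre has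
  -- velocity in `ker L`, which `Φ.symm` sends into the kernel of `dζ`, where the gradient of `f`
  -- vanishes.
  have hconst : ∀ t ∈ Metric.ball p.1 ε, ∀ x ∈ Metric.ball p.2.1 ε, ∀ e ∈ Metric.ball e₀ δ,
      ∀ e' ∈ Metric.ball e₀ δ, L e = L e' →
      f (t, x, Φ.symm e) = f (t, x, Φ.symm e') := by
    intro t ht x hx e he e' he' hee
    have hseg : ∀ s ∈ Set.Icc (0 : ℝ) 1, e + s • (e' - e) ∈ Metric.ball e₀ δ := fun s hs =>
      (convex_ball e₀ δ).add_smul_sub_mem he he' hs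
    have hd : ∀ s ∈ Set.Icc (0 : ℝ) 1,
        HasDerivAt (fun s : ℝ => f (t, x, Φ.symm (e + s • (e' - e)))) 0 s := by
      intro s hs
      have hm := hseg s hs
      have hl : HasDerivAt (fun s : ℝ => e + s • (e' - e)) (e' - e) s := by
        simpa using ((hasDerivAt_id s).smul_const (e' - e)).const_add e
      have hΨd := (hΨδ.differentiableAt_of_isOpen Metric.isOpen_ball hm).hasFDerivAt
      have hc := hΨd.comp_hasDerivAt s hl
      have hfd := (hasFDerivAt_comp_paramSlice (hf.differentiableAt_of_isOpen
        Metric.isOpen_ball (hmem t ht x hx _ hm))).comp_hasDerivAt s hc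
      have hζd := (hζ.differentiableAt_of_isOpen Metric.isOpen_ball (hΨU _ hm)).hasFDerivAt
      have h0 : fderiv ℝ ζ (Φ.symm (e + s • (e' - e)))
          (fderiv ℝ Φ.symm (e + s • (e' - e)) (e' - e)) = 0 := by
        have h1 := hζd.comp _ hΨd
        have h2 : HasFDerivAt (ζ ∘ Φ.symm) L (e + s • (e' - e)) :=
          L.hasFDerivAt.congr_of_eventuallyEq (Filter.eventually_of_mem
            (Metric.isOpen_ball.mem_nhds hm) hζΨ)
        have h3 := DFunLike.congr_fun (h1.unique h2) (e' - e)
        rw [map_sub L, hee, sub_self] at h3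
        exact h3
      rw [hker _ (hmem t ht x hx _ hm) _ h0] at hfd
      exact hfd
    have := constant_of_has_deriv_right_zero
      (fun s hs => (hd s hs).continuousAt.continuousWithinAt)
      (fun s hs => (hd s ⟨hs.1, hs.2.le⟩).hasDerivWithinAt) 1 ⟨zero_le_one, le_rfl⟩
    simpa using this.symm
  -- Both `Φ κ` and its representative `σ (L (Φ κ))` in the same fibre must lie in the ball for
  -- `hconst` to compare them.
  let V : Set (ℝ × ℝ × (Fin ρ → ℝ)) := Metric.ball p ε ∩
    (fun q : ℝ × ℝ × (Fin ρ → ℝ) => q.2.2) ⁻¹'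
      (Φ.source ∩ Φ ⁻¹' (Metric.ball e₀ δ ∩ (fun e => σ (L e)) ⁻¹' Metric.ball e₀ δ))
  refine ⟨V, fun z => f (z.1, z.2.1, Φ.symm (σ z.2.2)), W, ?_, ⟨Metric.mem_ball_self hε, hcs, ?_, ?_⟩,
    Set.inter_subset_left, hW, ?_, ?_⟩
  · exact Metric.isOpen_ball.inter (((Φ.continuousOn.isOpen_inter_preimage Φ.open_source
      (Metric.isOpen_ball.inter (Metric.isOpen_ball.preimage
        (hσ.continuous.comp L.continuous)))).preimage (continuous_snd.comp continuous_snd)))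
  · exact Metric.mem_ball_self hδ
  · change σ (L e₀) ∈ Metric.ball e₀ δ
    simpa [σ] using hδ
  · have hΨσ : ContDiffOn ℝ ∞ (fun z : ℝ × ℝ × (Fin k → ℝ) => Φ.symm (σ z.2.2)) W :=
      hΨδ.comp (hσ.comp (contDiff_snd.comp contDiff_snd)).contDiffOn fun z hz => hz.2.2
    exact hf.comp (contDiff_fst.contDiffOn.prodMk
      ((contDiff_fst.comp contDiff_snd).contDiffOn.prodMk hΨσ))
      fun z hz => hmem _ hz.1 _ hz.2.1 _ hz.2.2
  · rintro ⟨t, x, κ⟩ ⟨hq, hκ, hκ1, hκ2⟩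
    obtain ⟨h1, h2, h3⟩ := mem_ball_prod_iff.1 hq
    have hζκ : L (Φ κ) = ζ κ := hΦ κ hκ
    have hκ2' : σ (ζ κ) ∈ Metric.ball e₀ δ := by rw [← hζκ]; exact hκ2
    refine ⟨⟨h1, h2, hκ2'⟩, ?_⟩
    have := hconst t h1 x h2 (Φ κ) hκ1 (σ (ζ κ)) hκ2' (by simp [σ, hLR, hζκ])
    rwa [Φ.left_inv hκ] at this

end LocalFactorization

/-! ### Essential parameters, ranks and regular points. -/

section EssentialParameters

variable {ρ : ℕ} {Ω : Set (ℝ × ℝ × (Fin ρ → ℝ))} {f : ℝ × ℝ × (Fin ρ → ℝ) → ℝ}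

theorem det_paramJacobian_eq_zero_iff (hΩ : IsOpen Ω) (hf : ContDiffOn ℝ ∞ f Ω)
    {q : ℝ × ℝ × (Fin ρ → ℝ)} (hq : q ∈ Ω) :
    (paramJacobian f ρ q).det = 0 ↔ ∃ w ≠ 0, paramGradMap f ρ q w = 0 := by
  rw [← Matrix.exists_mulVec_eq_zero_iff]
  have h : ∀ w, (paramJacobian f ρ q).mulVec w = paramGradMap f ρ q w := fun w =>
    LinearMap.congr_fun (toLin'_paramJacobian hΩ hf ρ hq) w
  simp only [h]

/-- Differentiation in `x` leaves `ζ` untouched, so each `f_a` factors through the same `ζ`, and a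
nonzero vector of `ker dζ`, which exists since `m < ρ`, kills every row of the Jacobian. -/
theorem det_paramJacobian_eq_zero_of_not_essential (hΩ : IsOpen Ω) (hf : ContDiffOn ℝ ∞ f Ω)
    (h : ¬ EssentialParametersOn f Ω) {q : ℝ × ℝ × (Fin ρ → ℝ)} (hq : q ∈ Ω) :
    (paramJacobian f ρ q).det = 0 := by
  obtain ⟨m, hm, ζ, g, W, hW, hg, hζ, hfac⟩ := not_not.1 h
  obtain ⟨t, x, κ⟩ := q
  have hU : IsOpen ((fun p : ℝ × ℝ × (Fin ρ → ℝ) => p.2.2) '' Ω) :=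
    (isOpenMap_snd.comp isOpenMap_snd) Ω hΩ
  have hζd := (hζ.differentiableAt_of_isOpen hU ⟨_, hq, rfl⟩).hasFDerivAt
  obtain ⟨w, hw, hw0⟩ := (Submodule.ne_bot_iff _).1
    (LinearMap.ker_ne_bot_of_finrank_lt
      (f := (fderiv ℝ ζ κ : (Fin ρ → ℝ) →ₗ[ℝ] (Fin m → ℝ))) (by simpa using hm))
  refine (det_paramJacobian_eq_zero_iff hΩ hf hq).2 ⟨w, hw0,
    (paramGradMap_eq_zero_iff f ρ _ w).2 fun a _ => ?_⟩
  have hxD : ∀ q ∈ Ω, xDeriv f a q = xDeriv g a (q.1, q.2.1, ζ q.2.2) := by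
    rintro ⟨t, x, κ⟩ hq
    refine Filter.EventuallyEq.iteratedDeriv_eq a ?_
    exact ((hasDerivAt_xLine t x κ).continuousAt.eventually (hΩ.mem_nhds hq)).mono
      fun y hy => (hfac _ hy).2
  have h1 := hasFDerivAt_comp_paramSlice
    ((contDiffOn_xDeriv hΩ hf a).differentiableAt_of_isOpen hΩ hq)
  have h2 := (hasFDerivAt_comp_paramSlice
    ((contDiffOn_xDeriv hW hg a).differentiableAt_of_isOpen hW (hfac _ hq).1)).comp κ hζd
  have h3 : (fun κ' => xDeriv f a (t, x, κ')) =ᶠ[𝓝 κ]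
      (fun z => xDeriv g a (t, x, z)) ∘ ζ :=
    ((hasFDerivAt_paramSlice t x κ).continuousAt.eventually (hΩ.mem_nhds hq)).mono
      fun κ' hκ' => hxD _ hκ'
  rw [h1.unique (h2.congr_of_eventuallyEq h3)]
  change paramGrad (xDeriv g a) _ (fderiv ℝ ζ κ w) = 0
  rw [show fderiv ℝ ζ κ w = 0 from hw, map_zero]

theorem EssentialParametersOn.of_det_ne_zero (hΩ : IsOpen Ω) (hf : ContDiffOn ℝ ∞ f Ω)
    {q : ℝ × ℝ × (Fin ρ → ℝ)} (hq : q ∈ Ω) (h : (paramJacobian f ρ q).det ≠ 0) :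
    EssentialParametersOn f Ω :=
  by_contra fun hn => h (det_paramJacobian_eq_zero_of_not_essential hΩ hf hn hq)

/-- For a solution family, parameter directions annihilated by all `∂f_n/∂κ` are annihilated by
`∂f_t/∂κ`. -/
theorem IsSolutionFamily.paramGrad_tDeriv_eq_zero {r : ℕ} {E : EvolutionEquation r}
    (hΩ : IsOpen Ω) (hf : IsSolutionFamily E f Ω) {q : ℝ × ℝ × (Fin ρ → ℝ)} (hq : q ∈ Ω)
    {w : Fin ρ → ℝ} (hw : ∀ n, paramGrad (xDeriv f n) q w = 0) :
    paramGrad (dirDeriv (1, 0, 0) f) q w = 0 := by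
  obtain ⟨hfs, hsol⟩ := hf
  have heq : Set.EqOn (dirDeriv (1, 0, 0) f)
      (fun p => E.H (p.1, p.2.1, fun k : Fin (r + 1) => xDeriv f k p)) Ω := fun p hp => by
    rw [← tDeriv_eqOn hΩ hfs hp]
    exact (hsol p hp).2
  rw [paramGrad_congr hΩ heq hq]
  obtain ⟨t, x, κ⟩ := q
  have hH := (E.smooth.differentiableAt_of_isOpen E.isOpen_domain (hsol _ hq).1)
  have hin : HasFDerivAt (fun κ' : Fin ρ → ℝ => fun k : Fin (r + 1) => xDeriv f k (t, x, κ'))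
      (ContinuousLinearMap.pi fun k : Fin (r + 1) => paramGrad (xDeriv f k) (t, x, κ)) κ :=
    hasFDerivAt_pi.2 fun k => hasFDerivAt_comp_paramSlice
      ((contDiffOn_xDeriv hΩ hfs k).differentiableAt_of_isOpen hΩ hq)
  have h1 := (hasFDerivAt_comp_paramSlice hH).comp κ hin
  have h2 := hasFDerivAt_comp_paramSlice (((contDiffOn_dirDeriv hΩ hfs (1, 0, 0)).congr
    heq.symm).differentiableAt_of_isOpen hΩ hq)
  rw [h2.unique h1]
  change paramGrad E.H _ (ContinuousLinearMap.pi
    (fun k : Fin (r + 1) => paramGrad (xDeriv f k) (t, x, κ)) w) = 0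
  have h3 : ContinuousLinearMap.pi
    (fun k : Fin (r + 1) => paramGrad (xDeriv f k) (t, x, κ)) w = 0 := funext fun k => hw k
  rw [h3, map_zero]

theorem surjective_paramGradMap_iff (hΩ : IsOpen Ω) (hf : ContDiffOn ℝ ∞ f Ω) {k : ℕ}
    {q : ℝ × ℝ × (Fin ρ → ℝ)} (hq : q ∈ Ω) :
    Function.Surjective (paramGradMap f k q) ↔ (paramJacobian f k q).rank = k := by
  rw [rank_paramJacobian hΩ hf k hq]
  constructor
  · intro h
    rw [LinearMap.range_eq_top.2 h, finrank_top]
    simp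
  · intro h
    exact LinearMap.range_eq_top.1 (Submodule.eq_top_of_finrank_eq (by simpa using h))

/-- If `∂(f_0, …, f_k)/∂κ` has no larger rank than `∂(f_0, …, f_{k-1})/∂κ`, then these have the same
kernel. -/
theorem paramGrad_eq_zero_of_rank_le (hΩ : IsOpen Ω) (hf : ContDiffOn ℝ ∞ f Ω) {k : ℕ}
    {q : ℝ × ℝ × (Fin ρ → ℝ)} (hq : q ∈ Ω)
    (h : (paramJacobian f (k + 1) q).rank ≤ (paramJacobian f k q).rank) {w : Fin ρ → ℝ}
    (hw : paramGradMap f k q w = 0) : paramGrad (xDeriv f k) q w = 0 := by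
  rw [rank_paramJacobian hΩ hf _ hq, rank_paramJacobian hΩ hf _ hq] at h
  have h1 := LinearMap.finrank_range_add_finrank_ker
    (paramGradMap f k q : (Fin ρ → ℝ) →ₗ[ℝ] (Fin k → ℝ))
  have h2 := LinearMap.finrank_range_add_finrank_ker
    (paramGradMap f (k + 1) q : (Fin ρ → ℝ) →ₗ[ℝ] (Fin (k + 1) → ℝ))
  have hle : (paramGradMap f (k + 1) q : (Fin ρ → ℝ) →ₗ[ℝ] (Fin (k + 1) → ℝ)).ker ≤
      (paramGradMap f k q : (Fin ρ → ℝ) →ₗ[ℝ] (Fin k → ℝ)).ker := fun v hv =>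
    (paramGradMap_eq_zero_iff f k q v).2 fun i hi =>
      (paramGradMap_eq_zero_iff f (k + 1) q v).1 hv i (hi.trans (Nat.lt_succ_self k))
  have heq := Submodule.eq_of_le_of_finrank_le hle (by omega)
  have hw' : w ∈ (paramGradMap f (k + 1) q : (Fin ρ → ℝ) →ₗ[ℝ] (Fin (k + 1) → ℝ)).ker :=
    heq ▸ hw
  exact (paramGradMap_eq_zero_iff f (k + 1) q w).1 hw' k (Nat.lt_succ_self k)

/-- At the first failure of surjectivity, passing from `k` to `k + 1` rows does not raise the rank
at `p`; regularity extends this to a neighbourhood, where adding `f_k` therefore does not shrink the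
kernel. -/
theorem exists_not_essential_of_regular {r : ℕ} {E : EvolutionEquation r} (hΩ : IsOpen Ω)
    (hf : IsSolutionFamily E f Ω) {p : ℝ × ℝ × (Fin ρ → ℝ)} (hp : p ∈ Ω)
    (hreg : ∀ k ≤ ρ, ∀ᶠ q in 𝓝 p, (paramJacobian f k q).rank = (paramJacobian f k p).rank)
    (hdet : (paramJacobian f ρ p).det = 0) :
    ∃ V : Set (ℝ × ℝ × (Fin ρ → ℝ)), IsOpen V ∧ p ∈ V ∧ V ⊆ Ω ∧ ¬ EssentialParametersOn f V := by
  classical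
  have hfs := hf.1
  have hρ : ¬ Function.Surjective (paramGradMap f ρ p) := fun hs => by
    obtain ⟨w, hw, hw0⟩ := (det_paramJacobian_eq_zero_iff hΩ hfs hp).1 hdet
    have hinj : Function.Injective
        (paramGradMap f ρ p : (Fin ρ → ℝ) →ₗ[ℝ] (Fin ρ → ℝ)) :=
      LinearMap.injective_iff_surjective.2 hs
    exact hw (hinj (hw0.trans (map_zero _).symm))
  have hex : ∃ n, ¬ Function.Surjective (paramGradMap f n p) := ⟨ρ, hρ⟩
  -- With no rows the target is a point and surjectivity is automatic, so the first failure has the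
  -- form `k + 1`.
  obtain ⟨k, hk⟩ : ∃ k, Nat.find hex = k + 1 := Nat.exists_eq_succ_of_ne_zero fun h0 => by
    have := Nat.find_spec hex
    rw [h0] at this
    exact this fun z => ⟨0, Subsingleton.elim _ _⟩
  have hkρ : k + 1 ≤ ρ := hk ▸ Nat.find_min' hex hρ
  have hsurj : Function.Surjective (paramGradMap f k p) :=
    not_not.1 (Nat.find_min hex (m := k) (by omega))
  have hnsurj : ¬ Function.Surjective (paramGradMap f (k + 1) p) := hk ▸ Nat.find_spec hex
  rw [surjective_paramGradMap_iff hΩ hfs hp] at hnsurj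
  have hrk := (surjective_paramGradMap_iff hΩ hfs hp).1 hsurj
  have hrk1 : (paramJacobian f (k + 1) p).rank ≤ k := by
    have := (paramJacobian f (k + 1) p).rank_le_height
    omega
  have hker : ∀ᶠ q in 𝓝 p, ∀ w, paramGradMap f k q w = 0 → paramGrad (xDeriv f k) q w = 0 := by
    filter_upwards [hreg k (by omega), hreg (k + 1) hkρ, hΩ.mem_nhds hp] with q h1 h2 hq w hw
    exact paramGrad_eq_zero_of_rank_le hΩ hfs hq (by omega) hw
  obtain ⟨ε, hε, hB, hinv⟩ := exists_ball_paramGrad_eq_zero hΩ hfs hp hsurj hker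
    fun q hq w hw => hf.paramGrad_tDeriv_eq_zero hΩ hq hw
  -- The reduced parameters are the first `k` Cauchy data of the solution at the base point.
  let ζ : (Fin ρ → ℝ) → (Fin k → ℝ) := fun κ i => xDeriv f i (p.1, p.2.1, κ)
  have hslice : ∀ κ ∈ Metric.ball p.2.2 ε, (p.1, p.2.1, κ) ∈ Metric.ball p ε := fun κ hκ =>
    mem_ball_prod_iff.2 ⟨Metric.mem_ball_self hε, Metric.mem_ball_self hε, hκ⟩
  have hζ : ContDiffOn ℝ ∞ ζ (Metric.ball p.2.2 ε) := contDiffOn_pi.2 fun i =>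
    (contDiffOn_xDeriv hΩ hfs i).comp
      (contDiff_const.prodMk (contDiff_const.prodMk contDiff_id)).contDiffOn
      fun κ hκ => hB (hslice κ hκ)
  have hζd : ∀ κ ∈ Metric.ball p.2.2 ε, fderiv ℝ ζ κ = paramGradMap f k (p.1, p.2.1, κ) :=
    fun κ hκ => (hasFDerivAt_pi.2 fun i : Fin k => hasFDerivAt_comp_paramSlice
      ((contDiffOn_xDeriv hΩ hfs i).differentiableAt_of_isOpen hΩ (hB (hslice κ hκ)))).fderiv
  obtain ⟨V, g, W, hV, hpV, hVB, hW, hg, hfac⟩ := exists_factorization hε (hfs.mono hB) hζ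
    (by rw [hζd _ (Metric.mem_ball_self hε)]; exact hsurj)
    fun q hq w hw => hinv q hq w (by rwa [hζd _ (mem_ball_prod_iff.1 hq).2.2] at hw)
  refine ⟨V, hV, hpV, hVB.trans hB, not_not.2 ⟨k, hkρ, ζ, g, W, hW, hg, hζ.mono ?_, hfac⟩⟩
  rintro _ ⟨q, hq, rfl⟩
  exact (mem_ball_prod_iff.1 (hVB hq)).2.2

/-- Rank is lower semicontinuous: linear maps of rank at least `n` form an open set. -/
theorem eventually_rank_paramJacobian_le (hΩ : IsOpen Ω) (hf : ContDiffOn ℝ ∞ f Ω)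
    {p : ℝ × ℝ × (Fin ρ → ℝ)} (hp : p ∈ Ω) (k : ℕ) :
    ∀ᶠ q in 𝓝 p, (paramJacobian f k p).rank ≤ (paramJacobian f k q).rank := by
  have hiff : ∀ q ∈ Ω, ∀ n : ℕ, (n : Cardinal) ≤
      (paramGradMap f k q : (Fin ρ → ℝ) →ₗ[ℝ] (Fin k → ℝ)).rank ↔
        n ≤ (paramJacobian f k q).rank := by
    intro q hq n
    rw [rank_paramJacobian hΩ hf k hq, LinearMap.rank, ← Module.finrank_eq_rank, Nat.cast_le]
  have hopen := isOpen_setOfPred_nat_le_rank (𝕜 := ℝ) (E := Fin ρ → ℝ) (F := Fin k → ℝ)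
    (paramJacobian f k p).rank
  have hc := (continuousOn_paramGradMap hΩ hf k).continuousAt (hΩ.mem_nhds hp)
  filter_upwards [hc.eventually (hopen.mem_nhds ((hiff p hp _).2 le_rfl)), hΩ.mem_nhds hp]
    with q hq hqΩ
  exact (hiff q hqΩ _).1 hq

/-- Every nonempty open set contains a regular point. -/
theorem exists_regular_point (hΩ : IsOpen Ω) (hf : ContDiffOn ℝ ∞ f Ω) (hne : Ω.Nonempty) :
    ∃ p ∈ Ω, ∀ k ≤ ρ, ∀ᶠ q in 𝓝 p,
      (paramJacobian f k q).rank = (paramJacobian f k p).rank := by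
  -- The total rank is a bounded integer, so it attains a maximum on `Ω`. Near a maximum point no
  -- single rank can drop, hence none can rise.
  let S : ℝ × ℝ × (Fin ρ → ℝ) → ℕ := fun q =>
    ∑ k ∈ Finset.range (ρ + 1), (paramJacobian f k q).rank
  have hbdd : BddAbove (S '' Ω) := by
    refine ⟨∑ _k ∈ Finset.range (ρ + 1), ρ, ?_⟩
    rintro _ ⟨q, -, rfl⟩
    exact Finset.sum_le_sum fun k _ => by
      simpa using (paramJacobian f k q).rank_le_width
  obtain ⟨p, hp, hpS⟩ := Nat.sSup_mem (hne.image S) hbdd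
  refine ⟨p, hp, fun k hk => ?_⟩
  have hall : ∀ᶠ q in 𝓝 p, ∀ j ∈ Finset.range (ρ + 1),
      (paramJacobian f j p).rank ≤ (paramJacobian f j q).rank :=
    (Filter.eventually_all_finset _).2 fun j _ => eventually_rank_paramJacobian_le hΩ hf hp j
  filter_upwards [hall, hΩ.mem_nhds hp] with q hq hqΩ
  have hle : S q ≤ S p := hpS ▸ le_csSup hbdd ⟨q, hqΩ, rfl⟩
  exact ((Finset.sum_eq_sum_iff_of_le hq).1 ((Finset.sum_le_sum hq).antisymm hle) k
    (Finset.mem_range.2 (by omega))).symm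

end EssentialParameters

theorem mainTheorem10 {r ρ : ℕ} (E : EvolutionEquation r)
    (Ω : Set (ℝ × ℝ × (Fin ρ → ℝ))) (hΩ : IsOpen Ω)
    (f : ℝ × ℝ × (Fin ρ → ℝ) → ℝ) (hf : IsSolutionFamily E f Ω) :
    ((∀ V : Set (ℝ × ℝ × (Fin ρ → ℝ)), IsOpen V → V.Nonempty → V ⊆ Ω →
        EssentialParametersOn f V) ↔
      Ω ⊆ closure {p | p ∈ Ω ∧ (paramJacobian f ρ p).det ≠ 0}) ∧
    (∀ p ∈ Ω,
      (∀ k ≤ ρ, ∀ᶠ q in 𝓝 p, (paramJacobian f k q).rank = (paramJacobian f k p).rank) →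
      ((∀ V : Set (ℝ × ℝ × (Fin ρ → ℝ)), IsOpen V → p ∈ V → V ⊆ Ω →
          EssentialParametersOn f V) ↔
        (paramJacobian f ρ p).det ≠ 0)) := by
  refine ⟨⟨fun hess p hp => ?_, fun hdense V hV hne hVΩ => ?_⟩, fun p hp hreg =>
    ⟨fun hess hdet => ?_, fun hdet V hV hpV hVΩ =>
      EssentialParametersOn.of_det_ne_zero hV (hf.1.mono hVΩ) hpV hdet⟩⟩
  -- Off the closure the determinant vanishes on a nonempty open set; a regular point in it has a
  -- neighbourhood where the parameters are not essential.
  · by_contra hpc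
    have hU : IsOpen (Ω ∩ (closure {p | p ∈ Ω ∧ (paramJacobian f ρ p).det ≠ 0})ᶜ) :=
      hΩ.inter isClosed_closure.isOpen_compl
    obtain ⟨q, hq, hreg⟩ := exists_regular_point hU (hf.1.mono Set.inter_subset_left) ⟨p, hp, hpc⟩
    have hdet : (paramJacobian f ρ q).det = 0 :=
      by_contra fun h => hq.2 (subset_closure ⟨hq.1, h⟩)
    obtain ⟨V, hV, hqV, hVΩ, hn⟩ := exists_not_essential_of_regular hΩ hf hq.1 hreg hdet
    exact hn (hess V hV ⟨q, hqV⟩ hVΩ)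
  · obtain ⟨p, hpV⟩ := hne
    obtain ⟨q, hqV, -, hdet⟩ := mem_closure_iff.1 (hdense (hVΩ hpV)) V hV hpV
    exact EssentialParametersOn.of_det_ne_zero hV (hf.1.mono hVΩ) hqV hdet
  · obtain ⟨V, hV, hpV, hVΩ, hn⟩ := exists_not_essential_of_regular hΩ hf hp hreg hdet
    exact hn (hess V hV hpV hVΩ)
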